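/- Fix an integer $p\ge 2$. For every $n\ge 2$ let $\mathbf X_1,\dots,\mathbf X_n$ be independent random points with the uniform distribution on the unit sphere $\mathbb S^{p-1}\subset\mathbb R^p$, let $\Theta_{ij}\in[0,\pi]$ be the angle between the vectors from the origin to $\mathbf X_i$ and $\mathbf X_j$, and put $$\Theta_{\min}=\min\{\Theta_{ij}:1\le i<j\le n\},\qquad \Theta_{\max}=\max\{\Theta_{ij}:1\le i<j\le n\}.$$ Then, as $n\to\infty$, $n^{2/(p-1)}\,(\Theta_{\max}+\Theta_{\min}-\pi)$ converges weakly to the distribution of $X-Y$, where $X$ and $Y$ are i.i.d. real random variables with the distribution function $$F(x)=\begin{cases}1-e^{-Kx^{p-1}}, & x\ge 0,\\ 0, & x<0,\end{cases}\qquad K=\frac{1}{4\sqrt{\pi}}\,\frac{\Gamma(p/2)}{\Gamma((p+1)/2)}.$$ -/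

import Mathlib

open MeasureTheory ProbabilityTheory Filter

/-- The unit sphere `𝕊^{p-1}` of `ℝ^p`, as a type. -/
abbrev UnitSphere (p : ℕ) : Type := Metric.sphere (0 : EuclideanSpace ℝ (Fin p)) 1

/-- The uniform distribution on the unit sphere: the surface measure induced by
Lebesgue measure, normalized to total mass one. -/
noncomputable def uniformSphere (p : ℕ) : Measure (UnitSphere p) :=
  ((volume : Measure (EuclideanSpace ℝ (Fin p))).toSphere Set.univ)⁻¹ •
    (volume : Measure (EuclideanSpace ℝ (Fin p))).toSphere

/-- The index set of the pairs `i < j` of `n` points. -/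
abbrev IndexPair (n : ℕ) : Type := {q : Fin n × Fin n // q.1 < q.2}

/-- The angle in `[0, π]` between the vectors from the origin to the points `x i` and `x j`. -/
noncomputable def pairAngle {p n : ℕ} (x : Fin n → UnitSphere p) (q : IndexPair n) : ℝ :=
  InnerProductGeometry.angle (x q.1.1 : EuclideanSpace ℝ (Fin p))
    (x q.1.2 : EuclideanSpace ℝ (Fin p))

/-- The smallest angle between two of the points: for `n ≥ 2` the infimum is over a finite
nonempty family, hence a minimum. -/
noncomputable def angleMin {p n : ℕ} (x : Fin n → UnitSphere p) : ℝ :=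
  ⨅ q : IndexPair n, pairAngle x q

/-- The largest angle between two of the points: for `n ≥ 2` the supremum is over a finite
nonempty family, hence a maximum. -/
noncomputable def angleMax {p n : ℕ} (x : Fin n → UnitSphere p) : ℝ :=
  ⨆ q : IndexPair n, pairAngle x q

/-- The constant `K = Γ(p/2) / (4 √π Γ((p+1)/2))`. -/
noncomputable def limitConst (p : ℕ) : ℝ :=
  1 / (4 * Real.sqrt Real.pi) * (Real.Gamma ((p : ℝ) / 2) / Real.Gamma (((p : ℝ) + 1) / 2))

/-- The distribution function `F(x) = 1 - exp(-K x^{p-1})` for `x ≥ 0`, and `0` for `x < 0`. -/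
noncomputable def limitCDF (p : ℕ) (x : ℝ) : ℝ :=
  if 0 ≤ x then 1 - Real.exp (-limitConst p * x ^ (p - 1)) else 0

/-! Write `m = p - 1`. The gaps `Θ_min` and `π - Θ_max`, scaled by `n^(2/m)`, converge jointly to
independent variables with distribution function `F`; the theorem follows by the continuous map `(a,
b) ↦ a - b`.

The joint survival event says that no pair of points has an angle at most `s n^(-2/m)` or at least
`π` minus `t n^(-2/m)`. A cap of small radius `θ` has probability about `2Kθ^m`
(`tendsto_capProb_div_pow`), so a given pair is bad with probability `r`, where `n² r → 2K(s^m +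
t^m)` for `s, t ≥ 0`. There are about `n²/2` pairs, and if the pair events were independent the
survival probability would be about `(1 - r)^(n²/2)`, tending to `exp(-K s^m) exp(-K t^m)`. The
product form is the asymptotic independence of the two extremes.

Independence fails only slightly. Disjoint pairs give independent events, and pairs sharing one
point are still pairwise independent, because every section of the bad set has the same measure
(`pi_pairEvent_inter`). An induction over the pairs (`abs_pi_avoidEvent_sub_le`) bounds the total
error by `O(n² · n r²) = O(1/n)`. -/

/-! ### Spherical caps as cones in the ball -/

/-- The intersection of the punctured open unit ball with the cone of half-angle `θ` around `x`. -/
def solidCone {p : ℕ} (x : EuclideanSpace ℝ (Fin p)) (θ : ℝ) : Set (EuclideanSpace ℝ (Fin p)) :=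
  {v | v ≠ 0 ∧ ‖v‖ < 1 ∧ InnerProductGeometry.angle x v ≤ θ}

/-- The closed cap of angular radius `θ` around `x`. -/
def sphereCap {p : ℕ} (x : UnitSphere p) (θ : ℝ) : Set (UnitSphere p) :=
  {y | InnerProductGeometry.angle (x : EuclideanSpace ℝ (Fin p)) y ≤ θ}

lemma UnitSphere.ne_zero {p : ℕ} (x : UnitSphere p) : (x : EuclideanSpace ℝ (Fin p)) ≠ 0 :=
  ne_zero_of_mem_unit_sphere x

lemma measurable_angle_unitSphere {p : ℕ} :
    Measurable fun z : UnitSphere p × UnitSphere p =>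
      InnerProductGeometry.angle (z.1 : EuclideanSpace ℝ (Fin p)) z.2 := by
  unfold InnerProductGeometry.angle
  have : Continuous fun z : UnitSphere p × UnitSphere p =>
      Real.arccos (inner ℝ (z.1 : EuclideanSpace ℝ (Fin p)) (z.2 : EuclideanSpace ℝ (Fin p)) /
        (‖(z.1 : EuclideanSpace ℝ (Fin p))‖ * ‖(z.2 : EuclideanSpace ℝ (Fin p))‖)) := by
    refine Real.continuous_arccos.comp ?_
    simp only [norm_eq_of_mem_sphere]
    fun_prop
  exact this.measurable

lemma measurableSet_sphereCap {p : ℕ} (x : UnitSphere p) (θ : ℝ) :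
    MeasurableSet (sphereCap x θ) := by
  have h : Measurable fun y : UnitSphere p => (x, y) := measurable_prodMk_left
  exact (measurable_angle_unitSphere.comp h) measurableSet_Iic

-- `Measure.toSphere` is defined through the volume of the cone over a set with radii in `(0, 1)`;
-- this identifies that cone for a cap.
open scoped Pointwise in
lemma smul_sphereCap {p : ℕ} (x : UnitSphere p) (θ : ℝ) :
    Set.Ioo (0 : ℝ) 1 • (Subtype.val '' sphereCap x θ) =
      solidCone (x : EuclideanSpace ℝ (Fin p)) θ := by
  ext v
  simp only [Set.mem_smul, Set.mem_image, solidCone, sphereCap, Set.mem_ofPred_eq, Set.mem_Ioo]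
  constructor
  · rintro ⟨r, ⟨hr0, hr1⟩, _, ⟨y, hy, rfl⟩, rfl⟩
    refine ⟨smul_ne_zero hr0.ne' (UnitSphere.ne_zero y), ?_, ?_⟩
    · rw [norm_smul, norm_eq_of_mem_sphere, mul_one, Real.norm_of_nonneg hr0.le]
      exact hr1
    · rwa [InnerProductGeometry.angle_smul_right_of_pos _ _ hr0]
  · rintro ⟨h0, h1, h⟩
    have hn : 0 < ‖v‖ := norm_pos_iff.2 h0
    refine ⟨‖v‖, ⟨hn, h1⟩, ‖v‖⁻¹ • v, ⟨⟨‖v‖⁻¹ • v, ?_⟩, ?_, rfl⟩, ?_⟩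
    · simp [norm_smul, hn.ne']
    · rwa [InnerProductGeometry.angle_smul_right_of_pos _ _ (inv_pos.2 hn)]
    · rw [smul_smul, mul_inv_cancel₀ hn.ne', one_smul]

lemma uniformSphere_sphereCap {p : ℕ} (hp : p ≠ 0) (x : UnitSphere p) (θ : ℝ) :
    (uniformSphere p).real (sphereCap x θ) =
      (volume : Measure (EuclideanSpace ℝ (Fin p))).real (solidCone x θ) /
        (volume : Measure (EuclideanSpace ℝ (Fin p))).real (Metric.ball 0 1) := by
  have hp' : (p : ℝ) ≠ 0 := Nat.cast_ne_zero.2 hp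
  rw [uniformSphere, measureReal_ennreal_smul_apply, ENNReal.toReal_inv, ← measureReal_def,
    Measure.toSphere_real_apply_univ, measureReal_def (Measure.toSphere _),
    Measure.toSphere_apply' _ (measurableSet_sphereCap x θ), smul_sphereCap, ENNReal.toReal_mul,
    ← measureReal_def]
  simp only [finrank_euclideanSpace, Fintype.card_fin, ENNReal.toReal_natCast]
  rw [div_eq_inv_mul, mul_inv, mul_mul_mul_comm, inv_mul_cancel₀ hp', one_mul]

lemma isProbabilityMeasure_uniformSphere {p : ℕ} (hp : p ≠ 0) :
    IsProbabilityMeasure (uniformSphere p) := by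
  have : Nontrivial (EuclideanSpace ℝ (Fin p)) := by
    have : Nonempty (Fin p) := ⟨⟨0, Nat.pos_of_ne_zero hp⟩⟩
    infer_instance
  refine ⟨?_⟩
  rw [uniformSphere, Measure.smul_apply, smul_eq_mul]
  refine ENNReal.inv_mul_cancel ?_ (measure_ne_top _ _)
  simp [hp, (Metric.measure_ball_pos volume (0 : EuclideanSpace ℝ (Fin p)) one_pos).ne']

/-- The reflection in the hyperplane orthogonal to `x - y` sends `x` to `y` and preserves volume and
angles. Hence the probability of a cap does not depend on its centre. -/
lemma volume_solidCone_eq {p : ℕ} (x y : EuclideanSpace ℝ (Fin p)) (h : ‖x‖ = ‖y‖) (θ : ℝ) :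
    (volume : Measure (EuclideanSpace ℝ (Fin p))).real (solidCone x θ) =
      (volume : Measure (EuclideanSpace ℝ (Fin p))).real (solidCone y θ) := by
  set L := (ℝ ∙ (x - y))ᗮ.reflection
  have hL : L x = y := Submodule.reflection_sub h
  have : L ⁻¹' solidCone y θ = solidCone x θ := by
    ext v
    simp only [solidCone, Set.mem_preimage, Set.mem_ofPred_eq, LinearIsometryEquiv.norm_map,
      ne_eq, EmbeddingLike.map_eq_zero_iff]
    rw [← hL, ← LinearIsometryEquiv.coe_toLinearIsometry, LinearIsometry.angle_map]
  rw [← this, measureReal_def, measureReal_def]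
  congr 1
  exact L.measurePreserving.measure_preimage_equiv (f := L.toMeasurableEquiv) _

/-! ### Volume of a cone and the probability of a small cap -/

/-- The coordinates of `ℝ × ℝ^m` on `ℝ^(m+1)`. -/
noncomputable def splitFirst (m : ℕ) (v : EuclideanSpace ℝ (Fin (m + 1))) :
    ℝ × EuclideanSpace ℝ (Fin m) :=
  (v 0, WithLp.toLp 2 fun j => v j.succ)

lemma measurePreserving_splitFirst (m : ℕ) : MeasurePreserving (splitFirst m) := by
  have h1 : MeasurePreserving (@WithLp.ofLp 2 (Fin (m + 1) → ℝ)) :=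
    PiLp.volume_preserving_ofLp (Fin (m + 1))
  have h2 := volume_preserving_piFinSuccAbove (fun _ : Fin (m + 1) => ℝ) 0
  have h3 : MeasurePreserving (Prod.map (id : ℝ → ℝ) (@WithLp.toLp 2 (Fin m → ℝ))) :=
    (MeasurePreserving.id volume).prod (PiLp.volume_preserving_toLp (Fin m))
  exact h3.comp (h2.comp h1)

lemma norm_sq_splitFirst {m : ℕ} (v : EuclideanSpace ℝ (Fin (m + 1))) :
    ‖v‖ ^ 2 = (splitFirst m v).1 ^ 2 + ‖(splitFirst m v).2‖ ^ 2 := by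
  simp [EuclideanSpace.real_norm_sq_eq, Fin.sum_univ_succ, splitFirst]

/-- The straight cone of height `h` and slope `T` in `ℝ × ℝ^m`. -/
def straightCone (m : ℕ) (h T : ℝ) : Set (ℝ × EuclideanSpace ℝ (Fin m)) :=
  {z | z.1 ∈ Set.Ioo 0 h ∧ ‖z.2‖ ≤ T * z.1}

lemma measurableSet_straightCone (m : ℕ) (h T : ℝ) : MeasurableSet (straightCone m h T) :=
  (measurable_fst measurableSet_Ioo).inter
    (measurableSet_le measurable_snd.norm (measurable_fst.const_mul T))

/-- The volume of the unit ball of `ℝ^m`. -/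
noncomputable def unitBallVolume (m : ℕ) : ℝ :=
  Real.sqrt Real.pi ^ m / Real.Gamma ((m : ℝ) / 2 + 1)

lemma unitBallVolume_pos (m : ℕ) : 0 < unitBallVolume m := by
  have : 0 < Real.Gamma ((m : ℝ) / 2 + 1) := Real.Gamma_pos_of_pos (by positivity)
  unfold unitBallVolume
  positivity

lemma volume_closedBall_eq {m : ℕ} (hm : m ≠ 0) {r : ℝ} (hr : 0 ≤ r) :
    volume (Metric.closedBall (0 : EuclideanSpace ℝ (Fin m)) r) =
      ENNReal.ofReal (r ^ m * unitBallVolume m) := by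
  have : Nonempty (Fin m) := ⟨⟨0, Nat.pos_of_ne_zero hm⟩⟩
  rw [EuclideanSpace.volume_closedBall, Fintype.card_fin, ENNReal.ofReal_mul (by positivity),
    ENNReal.ofReal_pow hr, unitBallVolume]

lemma volume_ball_eq {m : ℕ} (hm : m ≠ 0) :
    (volume : Measure (EuclideanSpace ℝ (Fin m))).real (Metric.ball 0 1) = unitBallVolume m := by
  have : Nonempty (Fin m) := ⟨⟨0, Nat.pos_of_ne_zero hm⟩⟩
  rw [measureReal_def, EuclideanSpace.volume_ball, Fintype.card_fin, ENNReal.ofReal_one, one_pow,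
    one_mul, ← unitBallVolume, ENNReal.toReal_ofReal (unitBallVolume_pos m).le]

lemma volume_straightCone {m : ℕ} (hm : m ≠ 0) {h T : ℝ} (hh : 0 ≤ h) (hT : 0 ≤ T) :
    volume (straightCone m h T) =
      ENNReal.ofReal (T ^ m * unitBallVolume m * (h ^ (m + 1) / (m + 1))) := by
  have hint : IntervalIntegrable (fun t : ℝ => T ^ m * unitBallVolume m * t ^ m) volume 0 h :=
    (by fun_prop : Continuous _).intervalIntegrable _ _
  rw [Measure.volume_eq_prod, Measure.prod_apply (measurableSet_straightCone m h T)]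
  have key : ∀ t : ℝ, volume (Prod.mk t ⁻¹' straightCone m h T) =
      (Set.Ioo 0 h).indicator
        (fun t => ENNReal.ofReal (T ^ m * unitBallVolume m * t ^ m)) t := by
    intro t
    by_cases ht : t ∈ Set.Ioo 0 h
    · rw [Set.indicator_of_mem ht]
      have : Prod.mk t ⁻¹' straightCone m h T = Metric.closedBall 0 (T * t) := by
        ext w
        simp [straightCone, ht.1, ht.2]
      rw [this, volume_closedBall_eq hm (mul_nonneg hT ht.1.le)]
      congr 1
      ring
    · rw [Set.indicator_of_notMem ht]
      have : Prod.mk t ⁻¹' straightCone m h T = ∅ := by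
        ext w
        simp only [straightCone, Set.mem_preimage, Set.mem_ofPred_eq, ht, false_and,
          Set.mem_empty_iff_false]
      rw [this, measure_empty]
  simp_rw [key]
  rw [lintegral_indicator measurableSet_Ioo, Measure.restrict_congr_set Ioo_ae_eq_Ioc,
    ← ofReal_integral_eq_lintegral_ofReal hint.1, ← intervalIntegral.integral_of_le hh]
  · simp
  · filter_upwards [ae_restrict_mem measurableSet_Ioc] with t ht
    have := unitBallVolume_pos m
    have := ht.1
    positivity

/-- With `a` the height and `w` the distance to the axis, the angle condition is `cos θ * ‖v‖ ≤ a`.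
Squaring and `‖v‖² = a² + w²` turn it into `cos θ * w ≤ sin θ * a`. -/
lemma mem_solidCone_single_iff {m : ℕ} {θ : ℝ} (h0 : 0 ≤ θ) (h1 : θ < Real.pi / 2)
    (v : EuclideanSpace ℝ (Fin (m + 1))) :
    v ∈ solidCone (EuclideanSpace.single 0 1) θ ↔
      ‖v‖ < 1 ∧ 0 < (splitFirst m v).1 ∧
        ‖(splitFirst m v).2‖ ≤ Real.tan θ * (splitFirst m v).1 := by
  have hc : 0 < Real.cos θ := Real.cos_pos_of_mem_Ioo ⟨by linarith [Real.pi_pos], h1⟩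
  have hs : 0 ≤ Real.sin θ := Real.sin_nonneg_of_nonneg_of_le_pi h0 (by linarith [Real.pi_pos])
  have hsc := Real.sin_sq_add_cos_sq θ
  have hnorm := norm_sq_splitFirst v
  set a := (splitFirst m v).1 with ha
  set w := ‖(splitFirst m v).2‖ with hw
  have hw0 : 0 ≤ w := norm_nonneg _
  have hinner : inner ℝ (EuclideanSpace.single (0 : Fin (m + 1)) (1 : ℝ)) v = a := by
    simp [EuclideanSpace.inner_single_left, ha, splitFirst]
  have hang : v ≠ 0 → (InnerProductGeometry.angle (EuclideanSpace.single 0 1) v ≤ θ ↔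
      Real.cos θ * ‖v‖ ≤ a) := by
    intro hv
    have hv' : 0 < ‖v‖ := norm_pos_iff.2 hv
    rw [← Real.strictAntiOn_cos.le_iff_ge
      (⟨h0, by linarith [Real.pi_pos]⟩ : θ ∈ Set.Icc 0 Real.pi)
      ⟨InnerProductGeometry.angle_nonneg _ _, InnerProductGeometry.angle_le_pi _ _⟩,
      InnerProductGeometry.cos_angle, hinner]
    simp [le_div_iff₀ hv']
  have htan : w ≤ Real.tan θ * a ↔ Real.cos θ * w ≤ Real.sin θ * a := by
    rw [Real.tan_eq_sin_div_cos, div_mul_eq_mul_div, le_div_iff₀ hc, mul_comm w]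
  rw [htan]
  constructor
  · rintro ⟨hv, hlt, hle⟩
    have hv' : 0 < ‖v‖ := norm_pos_iff.2 hv
    rw [hang hv] at hle
    have hapos : 0 < a := lt_of_lt_of_le (by positivity) hle
    refine ⟨hlt, hapos, ?_⟩
    refine le_of_sq_le_sq ?_ (by positivity)
    have := pow_le_pow_left₀ (by positivity) hle 2
    nlinarith
  · rintro ⟨hlt, hapos, hle⟩
    have hv : v ≠ 0 := by
      rintro rfl
      simp [ha, splitFirst] at hapos
    refine ⟨hv, hlt, (hang hv).2 ?_⟩
    refine le_of_sq_le_sq ?_ hapos.le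
    have := pow_le_pow_left₀ (by positivity) hle 2
    nlinarith

lemma measureReal_preimage_straightCone {m : ℕ} (hm : m ≠ 0) {h T : ℝ} (hh : 0 ≤ h) (hT : 0 ≤ T) :
    volume.real (splitFirst m ⁻¹' straightCone m h T) =
      T ^ m * unitBallVolume m * (h ^ (m + 1) / (m + 1)) := by
  have := unitBallVolume_pos m
  rw [measureReal_def, (measurePreserving_splitFirst m).measure_preimage
    (measurableSet_straightCone m h T).nullMeasurableSet, volume_straightCone hm hh hT,
    ENNReal.toReal_ofReal (by positivity)]

/-- The solid cone lies between the straight cones of slope `tan θ` and heights `cos θ` and `1`: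
below height `cos θ` the distance to the axis is at most `sin θ`, so the norm stays below `1`. -/
lemma volume_solidCone_single_mem_Icc {m : ℕ} (hm : m ≠ 0) {θ : ℝ} (h0 : 0 ≤ θ)
    (h1 : θ < Real.pi / 2) :
    volume.real (solidCone (EuclideanSpace.single (0 : Fin (m + 1)) 1) θ) ∈ Set.Icc
      (Real.tan θ ^ m * unitBallVolume m * (Real.cos θ ^ (m + 1) / (m + 1)))
      (Real.tan θ ^ m * unitBallVolume m * (1 / (m + 1))) := by
  have hc : 0 < Real.cos θ := Real.cos_pos_of_mem_Ioo ⟨by linarith [Real.pi_pos], h1⟩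
  have ht : 0 ≤ Real.tan θ := Real.tan_nonneg_of_nonneg_of_le_pi_div_two h0 h1.le
  have hsub : solidCone (EuclideanSpace.single (0 : Fin (m + 1)) 1) θ ⊆ Metric.ball 0 1 :=
    fun v hv => by simpa using hv.2.1
  constructor
  · rw [← measureReal_preimage_straightCone hm hc.le ht]
    refine measureReal_mono ?_ (measure_ne_top_of_subset hsub measure_ball_lt_top.ne)
    rintro v ⟨⟨ha, ha'⟩, hw⟩
    refine (mem_solidCone_single_iff h0 h1 v).2 ⟨?_, ha, hw⟩
    have h2 : ‖v‖ ^ 2 < 1 ^ 2 := by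
      rw [norm_sq_splitFirst]
      have h3 := pow_le_pow_left₀ (norm_nonneg _) hw 2
      have h4 : (Real.tan θ * (splitFirst m v).1) ^ 2 ≤ Real.sin θ ^ 2 := by
        refine pow_le_pow_left₀ (by positivity) ?_ 2
        rw [Real.tan_eq_sin_div_cos, div_mul_eq_mul_div, div_le_iff₀ hc]
        exact mul_le_mul_of_nonneg_left ha'.le
          (Real.sin_nonneg_of_nonneg_of_le_pi h0 (by linarith [Real.pi_pos]))
      have h5 := pow_lt_pow_left₀ ha' ha.le two_ne_zero
      have := Real.sin_sq_add_cos_sq θ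
      linarith
    exact lt_of_pow_lt_pow_left₀ 2 zero_le_one h2
  · have := measureReal_preimage_straightCone (h := 1) hm zero_le_one ht
    rw [one_pow] at this
    rw [← this]
    refine measureReal_mono ?_ ?_
    · intro v hv
      obtain ⟨hn, ha, hw⟩ := (mem_solidCone_single_iff h0 h1 v).1 hv
      refine ⟨⟨ha, ?_⟩, hw⟩
      have h2 := norm_sq_splitFirst v
      nlinarith [norm_nonneg v, sq_nonneg ‖(splitFirst m v).2‖]
    · rw [(measurePreserving_splitFirst m).measure_preimage
        (measurableSet_straightCone m 1 _).nullMeasurableSet, volume_straightCone hm zero_le_one ht]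
      exact ENNReal.ofReal_ne_top

/-- The first basis vector as a point of the unit sphere. -/
noncomputable def northPole (m : ℕ) : UnitSphere (m + 1) :=
  ⟨EuclideanSpace.single 0 1, by simp⟩

/-- The uniform probability of a cap of angular radius `θ` in `𝕊^m`. -/
noncomputable def capProb (m : ℕ) (θ : ℝ) : ℝ :=
  (uniformSphere (m + 1)).real (sphereCap (northPole m) θ)

lemma uniformSphere_sphereCap_eq_capProb {m : ℕ} (x : UnitSphere (m + 1)) (θ : ℝ) :
    (uniformSphere (m + 1)).real (sphereCap x θ) = capProb m θ := by
  rw [capProb, uniformSphere_sphereCap m.succ_ne_zero, uniformSphere_sphereCap m.succ_ne_zero,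
    volume_solidCone_eq (x : EuclideanSpace ℝ (Fin (m + 1))) (northPole m)]
  rw [norm_eq_of_mem_sphere, norm_eq_of_mem_sphere]

lemma capProb_of_neg (m : ℕ) {θ : ℝ} (h : θ < 0) : capProb m θ = 0 := by
  have : sphereCap (northPole m) θ = ∅ := by
    ext y
    simpa [sphereCap] using h.trans_le (InnerProductGeometry.angle_nonneg _ _)
  rw [capProb, this, measureReal_empty]

lemma uniformSphere_antipodal_cap {m : ℕ} (x : UnitSphere (m + 1)) (θ : ℝ) :
    (uniformSphere (m + 1)).real
      {y | Real.pi - θ ≤ InnerProductGeometry.angle (x : EuclideanSpace ℝ (Fin (m + 1))) y} =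
      capProb m θ := by
  rw [← uniformSphere_sphereCap_eq_capProb (-x)]
  congr 1
  ext y
  have h : ((-x : UnitSphere (m + 1)) : EuclideanSpace ℝ (Fin (m + 1))) = -x := rfl
  simp only [sphereCap, Set.mem_ofPred_eq, h, InnerProductGeometry.angle_neg_left]
  constructor <;> intro h <;> linarith

/-- This is the source of `K`. The factor `2` cancels later against the count of about `n²/2` pairs.
-/
lemma unitBallVolume_ratio (m : ℕ) :
    unitBallVolume m / ((m + 1) * unitBallVolume (m + 1)) = 2 * limitConst (m + 1) := by
  have hpi : 0 < Real.sqrt Real.pi := Real.sqrt_pos.2 Real.pi_pos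
  have h1 : Real.Gamma ((m : ℝ) / 2 + 1) ≠ 0 := (Real.Gamma_pos_of_pos (by positivity)).ne'
  have h2 : Real.Gamma (((m : ℝ) + 1) / 2) ≠ 0 := (Real.Gamma_pos_of_pos (by positivity)).ne'
  have h3 : ((m : ℝ) + 1) ≠ 0 := by positivity
  have h4 : Real.Gamma (((m : ℝ) + 1) / 2 + 1) =
      ((m : ℝ) + 1) / 2 * Real.Gamma (((m : ℝ) + 1) / 2) :=
    Real.Gamma_add_one (by positivity)
  have h5 : ((m : ℝ) + 1 + 1) / 2 = (m : ℝ) / 2 + 1 := by ring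
  simp only [unitBallVolume, limitConst, Nat.cast_add, Nat.cast_one]
  rw [h4, h5, pow_succ]
  field_simp
  norm_num

lemma capProb_mem_Icc {m : ℕ} (hm : m ≠ 0) {θ : ℝ} (h0 : 0 ≤ θ) (h1 : θ < Real.pi / 2) :
    capProb m θ ∈ Set.Icc (2 * limitConst (m + 1) * Real.tan θ ^ m * Real.cos θ ^ (m + 1))
      (2 * limitConst (m + 1) * Real.tan θ ^ m) := by
  have h := volume_solidCone_single_mem_Icc hm h0 h1
  have hb := unitBallVolume_pos (m + 1)
  rw [← unitBallVolume_ratio, capProb, uniformSphere_sphereCap m.succ_ne_zero,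
    volume_ball_eq m.succ_ne_zero]
  have h3 : ((m : ℝ) + 1) ≠ 0 := by positivity
  constructor
  · rw [le_div_iff₀ hb]
    refine le_trans (le_of_eq ?_) h.1
    field_simp
  · rw [div_le_iff₀ hb]
    refine h.2.trans (le_of_eq ?_)
    field_simp

lemma capProb_zero {m : ℕ} (hm : m ≠ 0) : capProb m 0 = 0 := by
  have h := capProb_mem_Icc hm le_rfl (by positivity : (0 : ℝ) < Real.pi / 2)
  simp only [Real.tan_zero, zero_pow hm, mul_zero, zero_mul, Set.Icc_self] at h
  exact h

lemma tendsto_capProb_div_pow {m : ℕ} (hm : m ≠ 0) :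
    Tendsto (fun θ => capProb m θ / θ ^ m) (nhdsWithin 0 (Set.Ioi 0))
      (nhds (2 * limitConst (m + 1))) := by
  have htan : Tendsto (fun θ : ℝ => Real.tan θ / θ) (nhdsWithin 0 (Set.Ioi 0)) (nhds 1) := by
    have h := (Real.hasDerivAt_tan (x := 0) (by simp)).tendsto_slope_zero_right
    simpa [div_eq_inv_mul] using h
  have hcos : Tendsto (fun θ : ℝ => Real.cos θ) (nhdsWithin 0 (Set.Ioi 0)) (nhds 1) := by
    simpa using (Real.continuous_cos.tendsto 0).mono_left nhdsWithin_le_nhds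
  have hup : Tendsto (fun θ : ℝ => 2 * limitConst (m + 1) * (Real.tan θ / θ) ^ m)
      (nhdsWithin 0 (Set.Ioi 0)) (nhds (2 * limitConst (m + 1))) := by
    simpa using (htan.pow m).const_mul (2 * limitConst (m + 1))
  have hlow : Tendsto
      (fun θ : ℝ => 2 * limitConst (m + 1) * (Real.tan θ / θ) ^ m * Real.cos θ ^ (m + 1))
      (nhdsWithin 0 (Set.Ioi 0)) (nhds (2 * limitConst (m + 1))) := by
    simpa using hup.mul (hcos.pow (m + 1))
  have hmem : Set.Ioo (0 : ℝ) (Real.pi / 2) ∈ nhdsWithin (0 : ℝ) (Set.Ioi 0) :=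
    Ioo_mem_nhdsGT (by positivity)
  refine tendsto_of_tendsto_of_tendsto_of_le_of_le' hlow hup ?_ ?_
  · filter_upwards [hmem] with θ hθ
    rw [le_div_iff₀ (pow_pos hθ.1 m), div_pow]
    refine le_trans (le_of_eq ?_) (capProb_mem_Icc hm hθ.1.le hθ.2).1
    have : θ ^ m ≠ 0 := (pow_pos hθ.1 m).ne'
    field_simp
  · filter_upwards [hmem] with θ hθ
    rw [div_le_iff₀ (pow_pos hθ.1 m), div_pow]
    refine (capProb_mem_Icc hm hθ.1.le hθ.2).2.trans (le_of_eq ?_)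
    have : θ ^ m ≠ 0 := (pow_pos hθ.1 m).ne'
    field_simp

lemma tendsto_const_mul_rpow_neg {m : ℕ} (hm : m ≠ 0) (s : ℝ) :
    Tendsto (fun n : ℕ => s * (n : ℝ) ^ (-((2 : ℝ) / m))) atTop (nhds 0) := by
  have h : Tendsto (fun x : ℝ => x ^ (-((2 : ℝ) / m))) atTop (nhds 0) :=
    tendsto_rpow_neg_atTop (by positivity)
  simpa using (h.comp tendsto_natCast_atTop_atTop).const_mul s

/-- Caps whose radius shrinks like `n ^ (-2/m)` have probability of order `n⁻²`. -/
lemma tendsto_sq_mul_capProb {m : ℕ} (hm : m ≠ 0) (s : ℝ) :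
    Tendsto (fun n : ℕ => (n : ℝ) ^ 2 * capProb m (s * (n : ℝ) ^ (-((2 : ℝ) / m)))) atTop
      (nhds (2 * limitConst (m + 1) * max s 0 ^ m)) := by
  rcases le_or_gt s 0 with hs | hs
  · rw [max_eq_right hs, zero_pow hm, mul_zero]
    refine tendsto_const_nhds.congr' ?_
    filter_upwards [eventually_gt_atTop 0] with n hn
    have hpos : 0 < (n : ℝ) ^ (-((2 : ℝ) / m)) := Real.rpow_pos_of_pos (by positivity) _
    rcases hs.eq_or_lt with rfl | hs
    · rw [zero_mul, capProb_zero hm, mul_zero]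
    · rw [capProb_of_neg m (mul_neg_of_neg_of_pos hs hpos), mul_zero]
  · rw [max_eq_left hs.le]
    have hθ : Tendsto (fun n : ℕ => s * (n : ℝ) ^ (-((2 : ℝ) / m))) atTop
        (nhdsWithin 0 (Set.Ioi 0)) := by
      refine tendsto_nhdsWithin_iff.2 ⟨tendsto_const_mul_rpow_neg hm s, ?_⟩
      filter_upwards [eventually_gt_atTop 0] with n hn
      exact mul_pos hs (Real.rpow_pos_of_pos (by positivity) _)
    refine (((tendsto_capProb_div_pow hm).comp hθ).mul_const (s ^ m)).congr' ?_
    filter_upwards [eventually_gt_atTop 0] with n hn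
    have hn' : (0 : ℝ) < n := by positivity
    have hpow : ((n : ℝ) ^ (-((2 : ℝ) / m))) ^ m = ((n : ℝ) ^ 2)⁻¹ := by
      rw [← Real.rpow_natCast, ← Real.rpow_mul hn'.le, neg_mul,
        div_mul_cancel₀ _ (Nat.cast_ne_zero.2 hm), Real.rpow_neg hn'.le, Real.rpow_two]
    simp only [Function.comp_apply]
    rw [mul_pow, hpow]
    have : s ^ m ≠ 0 := (pow_pos hs m).ne'
    field_simp

/-! ### Approximate independence of the pair events -/

section Avoidance

variable {S : Type*} [MeasurableSpace S] {n : ℕ}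

/-- The configurations in which the pair of points indexed by `q` lies in `E`. -/
def pairEvent (E : Set (S × S)) (q : IndexPair n) : Set (Fin n → S) :=
  {x | (x q.1.1, x q.1.2) ∈ E}

/-- The configurations none of whose pairs indexed by `T` lies in `E`. -/
def avoidEvent (E : Set (S × S)) (T : Finset (IndexPair n)) : Set (Fin n → S) :=
  {x | ∀ q ∈ T, x ∉ pairEvent E q}

lemma measurableSet_pairEvent {E : Set (S × S)} (hE : MeasurableSet E) (q : IndexPair n) :
    MeasurableSet (pairEvent E q) := by
  have : Measurable fun x : Fin n → S => (x q.1.1, x q.1.2) := by fun_prop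
  exact this hE

lemma measurableSet_avoidEvent {E : Set (S × S)} (hE : MeasurableSet E)
    (T : Finset (IndexPair n)) : MeasurableSet (avoidEvent E T) := by
  have : avoidEvent E T = ⋂ q ∈ T, (pairEvent E q)ᶜ := by
    ext; simp [avoidEvent]
  rw [this]
  exact Finset.measurableSet_biInter _ fun q _ => (measurableSet_pairEvent hE q).compl

variable {μ : Measure S} [IsProbabilityMeasure μ]

lemma pi_map_pair {i j : Fin n} (hij : i ≠ j) :
    (Measure.pi fun _ : Fin n => μ).map (fun x => (x i, x j)) = μ.prod μ := by
  have hind : iIndepFun (fun i (x : Fin n → S) => x i) (Measure.pi fun _ : Fin n => μ) :=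
    iIndepFun_pi (X := fun _ => id) fun _ => aemeasurable_id
  have h := (indepFun_iff_map_prod_eq_prod_map_map (measurable_pi_apply i).aemeasurable
    (measurable_pi_apply j).aemeasurable).1 (hind.indepFun hij)
  rw [h]
  simp only [(measurePreserving_eval (fun _ : Fin n => μ) _).map_eq,
    show ∀ i : Fin n, (fun x : Fin n → S => x i) = Function.eval i from fun _ => rfl]

lemma pi_map_triple {i j k : Fin n} (hij : i ≠ j) (hik : i ≠ k) (hjk : j ≠ k) :
    (Measure.pi fun _ : Fin n => μ).map (fun x => (x i, x j, x k)) = μ.prod (μ.prod μ) := by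
  have hind : iIndepFun (fun i (x : Fin n → S) => x i) (Measure.pi fun _ : Fin n => μ) :=
    iIndepFun_pi (X := fun _ => id) fun _ => aemeasurable_id
  have h := (indepFun_iff_map_prod_eq_prod_map_map (measurable_pi_apply i).aemeasurable
    ((measurable_pi_apply j).prodMk (measurable_pi_apply k)).aemeasurable).1
    (hind.indepFun_prodMk (fun i => by fun_prop) j k i hij.symm hik.symm).symm
  rw [h, pi_map_pair hjk]
  simp only [(measurePreserving_eval (fun _ : Fin n => μ) _).map_eq,
    show ∀ i : Fin n, (fun x : Fin n → S => x i) = Function.eval i from fun _ => rfl]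

variable {E : Set (S × S)} {r : ℝ}

lemma measure_section (hsec : ∀ x, μ.real (Prod.mk x ⁻¹' E) = r) (x : S) :
    μ (Prod.mk x ⁻¹' E) = ENNReal.ofReal r := by
  rw [← hsec x, ofReal_measureReal]

lemma pi_pairEvent (hE : MeasurableSet E) (hr : 0 ≤ r)
    (hsec : ∀ x, μ.real (Prod.mk x ⁻¹' E) = r) (q : IndexPair n) :
    (Measure.pi fun _ : Fin n => μ).real (pairEvent E q) = r := by
  have h : (Measure.pi fun _ : Fin n => μ).map (fun x => (x q.1.1, x q.1.2)) E =
      (Measure.pi fun _ : Fin n => μ) (pairEvent E q) :=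
    Measure.map_apply (by fun_prop) hE
  rw [measureReal_def, ← h, pi_map_pair q.2.ne, Measure.prod_apply hE]
  simp [measure_section hsec, hr]

/-- Given the common point `x i`, the other two points are independent, and each falls in the
section with probability `r` whatever `x i` is. -/
lemma pi_two_pairs (hE : MeasurableSet E) (hr : 0 ≤ r)
    (hsec : ∀ x, μ.real (Prod.mk x ⁻¹' E) = r) {i j k : Fin n}
    (hij : i ≠ j) (hik : i ≠ k) (hjk : j ≠ k) :
    (Measure.pi fun _ : Fin n => μ).real {x | (x i, x j) ∈ E ∧ (x i, x k) ∈ E} = r ^ 2 := by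
  have hm : MeasurableSet {z : S × S × S | (z.1, z.2.1) ∈ E ∧ (z.1, z.2.2) ∈ E} :=
    MeasurableSet.inter
      ((by fun_prop : Measurable fun z : S × S × S => (z.1, z.2.1)) hE)
      ((by fun_prop : Measurable fun z : S × S × S => (z.1, z.2.2)) hE)
  have h : (Measure.pi fun _ : Fin n => μ).map (fun x => (x i, x j, x k)) _ =
      (Measure.pi fun _ : Fin n => μ) {x | (x i, x j) ∈ E ∧ (x i, x k) ∈ E} :=
    Measure.map_apply (by fun_prop) hm
  rw [measureReal_def, ← h, pi_map_triple hij hik hjk, Measure.prod_apply hm]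
  have : ∀ x : S, Prod.mk x ⁻¹' {z : S × S × S | (z.1, z.2.1) ∈ E ∧ (z.1, z.2.2) ∈ E} =
      (Prod.mk x ⁻¹' E) ×ˢ (Prod.mk x ⁻¹' E) := fun x => rfl
  simp [this, Measure.prod_prod, measure_section hsec, hr, sq]

/-- The pairs `q` and `q'` have an index in common. -/
def SharesIndex (q q' : IndexPair n) : Prop :=
  q.1.1 = q'.1.1 ∨ q.1.1 = q'.1.2 ∨ q.1.2 = q'.1.1 ∨ q.1.2 = q'.1.2

/-- Symmetry of `E` allows the common index to be written first in both pairs, which reduces all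
four cases to `pi_two_pairs`. -/
lemma pi_pairEvent_inter (hE : MeasurableSet E) (hsymm : ∀ x y, (x, y) ∈ E → (y, x) ∈ E)
    (hr : 0 ≤ r) (hsec : ∀ x, μ.real (Prod.mk x ⁻¹' E) = r) {q q' : IndexPair n}
    (hne : q ≠ q') (hsh : SharesIndex q q') :
    (Measure.pi fun _ : Fin n => μ).real (pairEvent E q ∩ pairEvent E q') = r ^ 2 := by
  have hs : ∀ x y, (x, y) ∈ E ↔ (y, x) ∈ E := fun x y => ⟨hsymm x y, hsymm y x⟩
  obtain ⟨⟨a, b⟩, hab : a < b⟩ := q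
  obtain ⟨⟨c, d⟩, hcd : c < d⟩ := q'
  have hne' : ¬(a = c ∧ b = d) := fun h => hne (by simp [h.1, h.2])
  simp only [SharesIndex] at hsh
  rcases hsh with h | h | h | h
  · subst h
    exact pi_two_pairs hE hr hsec hab.ne hcd.ne fun h => hne' ⟨rfl, h⟩
  · subst h
    rw [← pi_two_pairs hE hr hsec hab.ne hcd.ne' (hcd.trans hab).ne']
    congr 1
    ext x
    simp [pairEvent, hs (x c)]
  · subst h
    rw [← pi_two_pairs hE hr hsec hab.ne' hcd.ne (hab.trans hcd).ne]
    congr 1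
    ext x
    simp [pairEvent, hs (x a)]
  · subst h
    rw [← pi_two_pairs hE hr hsec hab.ne' hcd.ne' fun h => hne' ⟨h, rfl⟩]
    congr 1
    ext x
    simp [pairEvent, hs (x a), hs (x c)]

open Classical in
lemma card_sharesIndex_le (T : Finset (IndexPair n)) (q : IndexPair n) :
    (T.filter (SharesIndex q)).card ≤ 4 * n := by
  let U : Finset (Fin n × Fin n) :=
    ((Finset.univ.image fun k : Fin n => (q.1.1, k)) ∪ (Finset.univ.image fun k => (k, q.1.1))) ∪
      ((Finset.univ.image fun k => (q.1.2, k)) ∪ (Finset.univ.image fun k => (k, q.1.2)))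
  have h1 : (T.filter (SharesIndex q)).card ≤ U.card := by
    refine Finset.card_le_card_of_injOn Subtype.val ?_ Subtype.val_injective.injOn
    rintro ⟨⟨a, b⟩, hab⟩ hq
    simp only [Finset.coe_filter, Set.mem_ofPred_eq, SharesIndex] at hq
    rcases hq.2 with h | h | h | h <;> simp [U, h]
  have hcard : ∀ f : Fin n → Fin n × Fin n, (Finset.univ.image f).card ≤ n := fun f =>
    Finset.card_image_le.trans (by simp)
  refine h1.trans ((Finset.card_union_le _ _).trans ?_)
  have h2 := (Finset.card_union_le (Finset.univ.image fun k : Fin n => (q.1.1, k))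
    (Finset.univ.image fun k => (k, q.1.1)))
  have h3 := (Finset.card_union_le (Finset.univ.image fun k : Fin n => (q.1.2, k))
    (Finset.univ.image fun k => (k, q.1.2)))
  linarith [hcard fun k => (q.1.1, k), hcard fun k => (k, q.1.1), hcard fun k => (q.1.2, k),
    hcard fun k => (k, q.1.2)]

/-- The two events depend on disjoint blocks of coordinates. -/
lemma pi_pairEvent_inter_avoidEvent (hE : MeasurableSet E) (hr : 0 ≤ r)
    (hsec : ∀ x, μ.real (Prod.mk x ⁻¹' E) = r) (q : IndexPair n) (T : Finset (IndexPair n))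
    (hT : ∀ q' ∈ T, ¬SharesIndex q q') :
    (Measure.pi fun _ : Fin n => μ).real (pairEvent E q ∩ avoidEvent E T) =
      r * (Measure.pi fun _ : Fin n => μ).real (avoidEvent E T) := by
  have hind : iIndepFun (fun i (x : Fin n → S) => x i) (Measure.pi fun _ : Fin n => μ) :=
    iIndepFun_pi (X := fun _ => id) fun _ => aemeasurable_id
  let A : Finset (Fin n) := {q.1.1, q.1.2}
  have h := hind.indepFun_finset A Aᶜ disjoint_compl_right fun i => by fun_prop
  rw [indepFun_iff_measure_inter_preimage_eq_mul] at h
  let a : A := ⟨q.1.1, by simp [A]⟩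
  let b : A := ⟨q.1.2, by simp [A]⟩
  have hfst : ∀ q' ∈ T, q'.1.1 ∈ Aᶜ := fun q' hq' => by
    have := hT q' hq'
    simp only [SharesIndex, not_or] at this
    simp [A, Ne.symm this.1, Ne.symm this.2.2.1]
  have hsnd : ∀ q' ∈ T, q'.1.2 ∈ Aᶜ := fun q' hq' => by
    have := hT q' hq'
    simp only [SharesIndex, not_or] at this
    simp [A, Ne.symm this.2.1, Ne.symm this.2.2.2]
  have h1 : MeasurableSet {y : A → S | (y a, y b) ∈ E} :=
    (by fun_prop : Measurable fun y : A → S => (y a, y b)) hE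
  have h2 : MeasurableSet {y : (Aᶜ : Finset (Fin n)) → S |
      ∀ (q' : IndexPair n) (hq' : q' ∈ T), (y ⟨_, hfst q' hq'⟩, y ⟨_, hsnd q' hq'⟩) ∉ E} := by
    simp only [Set.ofPred_forall]
    refine MeasurableSet.iInter fun q' => MeasurableSet.iInter fun hq' => ?_
    exact ((by fun_prop : Measurable fun y : (Aᶜ : Finset (Fin n)) → S =>
      (y ⟨_, hfst q' hq'⟩, y ⟨_, hsnd q' hq'⟩)) hE).compl
  have h3 := congrArg ENNReal.toReal (h _ _ h1 h2)
  rw [ENNReal.toReal_mul] at h3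
  rw [← pi_pairEvent (μ := μ) hE hr hsec q]
  exact h3

-- Adding a pair `q` to `T` removes the probability of `pairEvent E q ∩ avoidEvent E T`. Replacing
-- `T` by its subset `R` of pairs disjoint from `q` makes this a product. The at most `4n` discarded
-- pairs cost at most `4n r` in the probability of avoidance and, by pairwise independence, `4n r²`
-- inside `pairEvent E q`.
open Classical in
lemma abs_pi_avoidEvent_sub_le (hE : MeasurableSet E) (hsymm : ∀ x y, (x, y) ∈ E → (y, x) ∈ E)
    (hr : 0 ≤ r) (hr1 : r ≤ 1) (hsec : ∀ x, μ.real (Prod.mk x ⁻¹' E) = r)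
    (T : Finset (IndexPair n)) :
    |(Measure.pi fun _ : Fin n => μ).real (avoidEvent E T) - (1 - r) ^ T.card| ≤
      T.card * (4 * n * r ^ 2) := by
  set ν := Measure.pi fun _ : Fin n => μ
  induction T using Finset.induction_on with
  | empty => simp [avoidEvent]
  | insert q T hq ih =>
    have hmT := measurableSet_avoidEvent hE T
    have hmq := measurableSet_pairEvent hE q
    set R := T.filter fun q' => ¬SharesIndex q q'
    set N := T.filter (SharesIndex q)
    have hTR : avoidEvent E T ⊆ avoidEvent E R := fun x hx q' hq' =>
      hx q' (Finset.mem_filter.1 hq').1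
    have hdiff : avoidEvent E R \ avoidEvent E T ⊆ ⋃ q' ∈ N, pairEvent E q' := by
      rintro x ⟨hxR, hxT⟩
      simp only [avoidEvent, Set.mem_ofPred_eq, not_forall, not_not] at hxT
      obtain ⟨q', hq', hx⟩ := hxT
      refine Set.mem_biUnion (x := q') ?_ hx
      by_contra hcon
      exact hxR q' (Finset.mem_filter.2 ⟨hq', fun h => hcon (Finset.mem_filter.2 ⟨hq', h⟩)⟩) hx
    have hNcard : (N.card : ℝ) ≤ 4 * n := by exact_mod_cast card_sharesIndex_le T q
    have hins : avoidEvent E (insert q T) = avoidEvent E T \ (pairEvent E q ∩ avoidEvent E T) := by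
      ext x
      simp only [avoidEvent, Finset.mem_insert, forall_eq_or_imp, Set.mem_ofPred_eq, Set.mem_sdiff,
        Set.mem_inter_iff]
      tauto
    have hval : ν.real (avoidEvent E (insert q T)) =
        ν.real (avoidEvent E T) - ν.real (pairEvent E q ∩ avoidEvent E T) := by
      rw [hins, measureReal_sdiff Set.inter_subset_right (hmq.inter hmT)]
    have hRmul : ν.real (pairEvent E q ∩ avoidEvent E R) = r * ν.real (avoidEvent E R) := by
      refine pi_pairEvent_inter_avoidEvent hE hr hsec q R fun q' hq' => ?_
      exact (Finset.mem_filter.1 hq').2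
    have hup : ν.real (pairEvent E q ∩ avoidEvent E T) ≤
        ν.real (pairEvent E q ∩ avoidEvent E R) :=
      measureReal_mono (Set.inter_subset_inter_right _ hTR)
    have hupR : ν.real (avoidEvent E T) ≤ ν.real (avoidEvent E R) := measureReal_mono hTR
    have hb1 : ν.real (avoidEvent E R) - ν.real (avoidEvent E T) ≤ 4 * n * r := by
      rw [← measureReal_sdiff hTR hmT]
      refine (measureReal_mono hdiff (measure_ne_top _ _)).trans ((measureReal_biUnion_finset_le _ _).trans ?_)
      rw [Finset.sum_congr rfl fun q' _ => pi_pairEvent (μ := μ) hE hr hsec q', Finset.sum_const,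
        nsmul_eq_mul]
      exact mul_le_mul_of_nonneg_right hNcard hr
    have hb2 : ν.real (pairEvent E q ∩ avoidEvent E R) -
        ν.real (pairEvent E q ∩ avoidEvent E T) ≤ 4 * n * r ^ 2 := by
      rw [← measureReal_sdiff (Set.inter_subset_inter_right _ hTR) (hmq.inter hmT)]
      have hsub : (pairEvent E q ∩ avoidEvent E R) \ (pairEvent E q ∩ avoidEvent E T) ⊆
          ⋃ q' ∈ N, (pairEvent E q ∩ pairEvent E q') := by
        rintro x ⟨⟨hxq, hxR⟩, hxT⟩
        have := hdiff ⟨hxR, fun h => hxT ⟨hxq, h⟩⟩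
        simp only [Set.mem_iUnion] at this ⊢
        obtain ⟨q', hq', hx⟩ := this
        exact ⟨q', hq', hxq, hx⟩
      refine (measureReal_mono hsub (measure_ne_top _ _)).trans ((measureReal_biUnion_finset_le _ _).trans ?_)
      have hsum : ∀ q' ∈ N, ν.real (pairEvent E q ∩ pairEvent E q') = r ^ 2 := fun q' hq' =>
        pi_pairEvent_inter hE hsymm hr hsec
          (fun h => hq (h ▸ (Finset.mem_filter.1 hq').1)) (Finset.mem_filter.1 hq').2
      rw [Finset.sum_congr rfl hsum, Finset.sum_const, nsmul_eq_mul]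
      exact mul_le_mul_of_nonneg_right hNcard (sq_nonneg r)
    rw [hval, Finset.card_insert_of_notMem hq, pow_succ]
    push_cast
    set u := ν.real (avoidEvent E T)
    set v := ν.real (pairEvent E q ∩ avoidEvent E T)
    -- The two replacement errors have opposite signs: passing from `T` to `R` inside `pairEvent E
    -- q` only raises `v`, and passing back in the product only lowers `r * P(R)`. So a single `4n
    -- r²` suffices on each side.
    have hv1 : v ≤ r * u + 4 * n * r ^ 2 := by nlinarith
    have hv2 : r * u - 4 * n * r ^ 2 ≤ v := by nlinarith
    have ih' := abs_le.1 ih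
    -- The factor `1 - r` lies in `[0, 1]`, so the earlier error is not amplified and the errors add
    -- up linearly.
    have hmul := abs_le.1 ((abs_mul (1 - r) (u - (1 - r) ^ T.card)).trans_le
      (mul_le_of_le_one_left (abs_nonneg _)
        (abs_le.2 ⟨by linarith, by linarith⟩)) |>.trans ih)
    rw [abs_le]
    constructor <;> nlinarith

end Avoidance

/-! ### Counting pairs and the Poisson limit -/

lemma two_mul_card_indexPair (n : ℕ) : 2 * (Fintype.card (IndexPair n) : ℝ) = n ^ 2 - n := by
  have h1 : Fintype.card (IndexPair n) =
      (Finset.univ.filter fun q : Fin n × Fin n => q.1 < q.2).card := Fintype.card_subtype _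
  have h2 : (Finset.univ.filter fun q : Fin n × Fin n => q.2 < q.1).card =
      (Finset.univ.filter fun q : Fin n × Fin n => q.1 < q.2).card :=
    Finset.card_bij (fun q _ => q.swap) (by simp) (by simp +contextual)
      fun q hq => ⟨q.swap, by simpa using hq, by simp⟩
  have h3 : (Finset.univ.filter fun q : Fin n × Fin n => q.1 = q.2).card = n := by
    rw [← Fintype.card_subtype]
    exact (Fintype.card_congr
      ⟨fun q => q.1.1, fun i => ⟨(i, i), rfl⟩, fun q => by
        obtain ⟨⟨a, b⟩, h⟩ := q
        cases h
        rfl, fun i => rfl⟩).trans (Fintype.card_fin n)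
  have h4 : (Finset.univ : Finset (Fin n × Fin n)).card = n * n := by simp
  have h5 : (Finset.univ : Finset (Fin n × Fin n)) =
      ((Finset.univ.filter fun q => q.1 < q.2) ∪ Finset.univ.filter fun q => q.2 < q.1) ∪
        Finset.univ.filter fun q => q.1 = q.2 := by
    ext ⟨a, b⟩
    simp only [Finset.mem_univ, Finset.mem_union, Finset.mem_filter, true_and, true_iff]
    rcases lt_trichotomy a b with h | h | h <;> simp [h]
  rw [h5, Finset.card_union_of_disjoint, Finset.card_union_of_disjoint, h2, h3, ← h1] at h4
  · have : (Fintype.card (IndexPair n) + Fintype.card (IndexPair n) + n : ℝ) = n * n := by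
      exact_mod_cast h4
    linarith
  · rw [Finset.disjoint_filter]
    exact fun q _ h => h.not_gt
  · rw [Finset.disjoint_left]
    simp only [Finset.mem_union, Finset.mem_filter, Finset.mem_univ, true_and]
    rintro q (h | h)
    exacts [h.ne, h.ne']

section PoissonLimit

variable {S : Type*} [MeasurableSpace S] {μ : Measure S} [IsProbabilityMeasure μ]

/-- If the sections of symmetric sets `E n` have probability `r n` with `n² r n → c`, then the
probability that no pair of `n` independent points lies in `E n` tends to `exp (-c/2)`. -/
lemma tendsto_pi_avoidEvent {E : ℕ → Set (S × S)} {r : ℕ → ℝ} {c : ℝ}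
    (hE : ∀ n, MeasurableSet (E n)) (hsymm : ∀ n x y, (x, y) ∈ E n → (y, x) ∈ E n)
    (hsec : ∀ᶠ n in atTop, ∀ x, μ.real (Prod.mk x ⁻¹' E n) = r n)
    (hr : Tendsto (fun n : ℕ => (n : ℝ) ^ 2 * r n) atTop (nhds c)) :
    Tendsto (fun n : ℕ => (Measure.pi fun _ : Fin n => μ).real
      (avoidEvent (E n) (Finset.univ : Finset (IndexPair n)))) atTop
      (nhds (Real.exp (-(c / 2)))) := by
  obtain ⟨x₀⟩ : Nonempty S := μ.nonempty_of_neZero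
  have hr01 : ∀ᶠ n in atTop, 0 ≤ r n ∧ r n ≤ 1 := by
    filter_upwards [hsec] with n hn
    rw [← hn x₀]
    exact ⟨measureReal_nonneg, measureReal_le_one⟩
  set N : ℕ → ℝ := fun n => (Fintype.card (IndexPair n) : ℝ) with hN
  have hNeq : ∀ n : ℕ, N n = (n ^ 2 - n) / 2 := fun n => by
    have := two_mul_card_indexPair n
    simp only [hN]
    linarith
  have hinv : Tendsto (fun n : ℕ => (n : ℝ)⁻¹) atTop (nhds 0) := tendsto_inv_atTop_nhds_zero_nat
  have hNr : Tendsto (fun n => N n * r n) atTop (nhds (c / 2)) := by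
    have h : Tendsto (fun n : ℕ => (1 - (n : ℝ)⁻¹) / 2 * ((n : ℝ) ^ 2 * r n)) atTop
        (nhds (c / 2)) := by
      have := ((hinv.const_sub 1).div_const 2).mul hr
      rwa [sub_zero, one_div, inv_mul_eq_div] at this
    refine h.congr' ?_
    filter_upwards [eventually_gt_atTop 0] with n hn
    have : (n : ℝ) ≠ 0 := by positivity
    rw [hNeq]
    field_simp
  have herr : Tendsto (fun n => N n * (4 * n * r n ^ 2)) atTop (nhds 0) := by
    -- Both `N n * r n` and `n² * r n` converge, which leaves a spare factor `1/n`.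
    have h : Tendsto (fun n : ℕ => 4 * (n : ℝ)⁻¹ * ((N n * r n) * ((n : ℝ) ^ 2 * r n))) atTop
        (nhds 0) := by
      simpa using (hinv.const_mul 4).mul (hNr.mul hr)
    refine h.congr' ?_
    filter_upwards [eventually_gt_atTop 0] with n hn
    have : (n : ℝ) ≠ 0 := by positivity
    field_simp
  have hr0 : Tendsto r atTop (nhds 0) := by
    have h : Tendsto (fun n : ℕ => (n : ℝ)⁻¹ ^ 2 * ((n : ℝ) ^ 2 * r n)) atTop (nhds 0) := by
      simpa using (hinv.pow 2).mul hr
    refine h.congr' ?_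
    filter_upwards [eventually_gt_atTop 0] with n hn
    have : (n : ℝ) ≠ 0 := by positivity
    field_simp
  have hpow : Tendsto (fun n => (1 - r n) ^ Fintype.card (IndexPair n)) atTop
      (nhds (Real.exp (-(c / 2)))) := by
    have hhalf : ∀ᶠ n in atTop, r n ≤ 1 / 2 :=
      (hr0.eventually_lt_const (by norm_num : (0 : ℝ) < 1 / 2)).mono fun _ h => h.le
    have hup : Tendsto (fun n => Real.exp (-(N n * r n))) atTop (nhds (Real.exp (-(c / 2)))) :=
      (Real.continuous_exp.tendsto _).comp hNr.neg
    have hlow : Tendsto (fun n => Real.exp (-(N n * r n / (1 - r n)))) atTop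
        (nhds (Real.exp (-(c / 2)))) := by
      have h := (hNr.div (hr0.const_sub 1) (by norm_num)).neg
      rw [sub_zero, div_one] at h
      exact (Real.continuous_exp.tendsto _).comp h
    refine tendsto_of_tendsto_of_tendsto_of_le_of_le' hlow hup ?_ ?_
    · filter_upwards [hr01, hhalf] with n hn hn'
      have h1 : 0 < 1 - r n := by linarith
      -- This is `1 / (1 - r) = 1 + r / (1 - r) ≤ exp (r / (1 - r))`, inverted.
      have h2 : Real.exp (-(r n / (1 - r n))) ≤ 1 - r n := by
        rw [Real.exp_neg, inv_le_comm₀ (Real.exp_pos _) h1]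
        refine le_trans (le_of_eq ?_) (Real.add_one_le_exp _)
        field_simp
        ring
      refine le_trans (le_of_eq ?_) (pow_le_pow_left₀ (Real.exp_pos _).le h2 _)
      rw [← Real.exp_nat_mul]
      congr 1
      simp only [hN]
      ring
    · filter_upwards [hr01] with n hn
      refine (pow_le_pow_left₀ (by linarith) (Real.one_sub_le_exp_neg (r n)) _).trans
        (le_of_eq ?_)
      rw [← Real.exp_nat_mul, mul_neg]
  have hdiff : Tendsto (fun n : ℕ => (Measure.pi fun _ : Fin n => μ).real
      (avoidEvent (E n) (Finset.univ : Finset (IndexPair n))) -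
        (1 - r n) ^ Fintype.card (IndexPair n)) atTop (nhds 0) := by
    refine squeeze_zero_norm' ?_ herr
    filter_upwards [hr01, hsec] with n hn hn'
    exact abs_pi_avoidEvent_sub_le (hE n) (hsymm n) hn.1 hn.2 hn' Finset.univ
  simpa using hdiff.add hpow

end PoissonLimit

/-! ### Weak convergence in the plane from survival functions -/

lemma measureReal_Ioc_prod_Ioc (μ : Measure (ℝ × ℝ)) [IsFiniteMeasure μ] {a b c d : ℝ}
    (hab : a ≤ b) (hcd : c ≤ d) :
    μ.real (Set.Ioc a b ×ˢ Set.Ioc c d) =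
      (μ.real (Set.Ioi a ×ˢ Set.Ioi c) - μ.real (Set.Ioi a ×ˢ Set.Ioi d)) -
        (μ.real (Set.Ioi b ×ˢ Set.Ioi c) - μ.real (Set.Ioi b ×ˢ Set.Ioi d)) := by
  have key : ∀ e : ℝ, μ.real (Set.Ioi e ×ˢ Set.Ioc c d) =
      μ.real (Set.Ioi e ×ˢ Set.Ioi c) - μ.real (Set.Ioi e ×ˢ Set.Ioi d) := fun e => by
    rw [← measureReal_sdiff (Set.prod_mono_right (Set.Ioi_subset_Ioi hcd))
      (measurableSet_Ioi.prod measurableSet_Ioi)]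
    congr 1
    ext
    simp only [Set.mem_prod, Set.mem_Ioi, Set.mem_Ioc, Set.mem_sdiff]
    grind
  rw [← key, ← key, ← measureReal_sdiff (Set.prod_mono_left (Set.Ioi_subset_Ioi hab))
      (measurableSet_Ioi.prod measurableSet_Ioc)]
  congr 1
  ext
  simp only [Set.mem_prod, Set.mem_Ioi, Set.mem_Ioc, Set.mem_sdiff]
  grind

/-- Convergence of the joint survival functions implies weak convergence on `ℝ × ℝ`. -/
lemma tendsto_probabilityMeasure_of_tendsto_survival {μ : ℕ → ProbabilityMeasure (ℝ × ℝ)}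
    {ν : ProbabilityMeasure (ℝ × ℝ)}
    (h : ∀ s t : ℝ, Tendsto (fun n => (μ n : Measure (ℝ × ℝ)).real (Set.Ioi s ×ˢ Set.Ioi t)) atTop
      (nhds ((ν : Measure (ℝ × ℝ)).real (Set.Ioi s ×ˢ Set.Ioi t)))) :
    Tendsto μ atTop (nhds ν) := by
  -- Half-open rectangles form a π-system containing arbitrarily small neighbourhoods of every
  -- point, so convergence of their masses suffices; these masses are alternating sums of survival
  -- values.
  refine ((isPiSystem_Ioc (id : ℝ → ℝ) id).prod
    (isPiSystem_Ioc (id : ℝ → ℝ) id)).tendsto_probabilityMeasure_of_tendsto_of_mem ?_ ?_ ?_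
  · rintro _ ⟨_, ⟨a, b, -, rfl⟩, _, ⟨c, d, -, rfl⟩, rfl⟩
    exact measurableSet_Ioc.prod measurableSet_Ioc
  · rintro u hu ⟨x, y⟩ hxy
    obtain ⟨ε, hε, hball⟩ := Metric.isOpen_iff.1 hu _ hxy
    refine ⟨Set.Ioc (x - ε / 2) (x + ε / 2) ×ˢ Set.Ioc (y - ε / 2) (y + ε / 2),
      Set.mem_image2_of_mem ⟨_, _, by simp only [id]; linarith, rfl⟩
        ⟨_, _, by simp only [id]; linarith, rfl⟩, ?_, ?_⟩
    · exact prod_mem_nhds (Ioc_mem_nhds (by linarith) (by linarith))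
        (Ioc_mem_nhds (by linarith) (by linarith))
    · rintro ⟨x', y'⟩ ⟨⟨h1, h2⟩, h3, h4⟩
      refine hball ?_
      rw [Metric.mem_ball, Prod.dist_eq, max_lt_iff, Real.dist_eq, Real.dist_eq, abs_lt, abs_lt]
      simp only at h1 h2 h3 h4 ⊢
      refine ⟨⟨?_, ?_⟩, ?_, ?_⟩ <;> linarith
  · rintro _ ⟨_, ⟨a, b, hab, rfl⟩, _, ⟨c, d, hcd, rfl⟩, rfl⟩
    have hreal : Tendsto
        (fun n => (μ n : Measure (ℝ × ℝ)).real (Set.Ioc (id a) (id b) ×ˢ Set.Ioc (id c) (id d)))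
        atTop (nhds ((ν : Measure (ℝ × ℝ)).real
          (Set.Ioc (id a) (id b) ×ˢ Set.Ioc (id c) (id d)))) := by
      simp_rw [measureReal_Ioc_prod_Ioc _ hab.le hcd.le]
      exact ((h _ _).sub (h _ _)).sub ((h _ _).sub (h _ _))
    simpa using hreal

/-! ### Joint limit of the two extreme angles -/

/-- The pairs of points at angle at most `s` or at least `π - t`. -/
def extremeAngleSet (p : ℕ) (s t : ℝ) : Set (UnitSphere p × UnitSphere p) :=
  {z | InnerProductGeometry.angle (z.1 : EuclideanSpace ℝ (Fin p)) z.2 ≤ s ∨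
    Real.pi - t ≤ InnerProductGeometry.angle (z.1 : EuclideanSpace ℝ (Fin p)) z.2}

lemma measurableSet_extremeAngleSet (p : ℕ) (s t : ℝ) :
    MeasurableSet (extremeAngleSet p s t) :=
  (measurable_angle_unitSphere measurableSet_Iic).union
    (measurable_angle_unitSphere measurableSet_Ici)

lemma extremeAngleSet_symm {p : ℕ} {s t : ℝ} {x y : UnitSphere p}
    (h : (x, y) ∈ extremeAngleSet p s t) : (y, x) ∈ extremeAngleSet p s t := by
  simpa only [extremeAngleSet, Set.mem_ofPred_eq, InnerProductGeometry.angle_comm] using h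

/-- The section is a cap around `x` together with a cap around `-x`, disjoint because `s + t < π`.
-/
lemma uniformSphere_section_extremeAngleSet {m : ℕ} {s t : ℝ} (hst : s + t < Real.pi)
    (x : UnitSphere (m + 1)) :
    (uniformSphere (m + 1)).real (Prod.mk x ⁻¹' extremeAngleSet (m + 1) s t) =
      capProb m s + capProb m t := by
  have := isProbabilityMeasure_uniformSphere m.succ_ne_zero
  have hmeas : MeasurableSet {y : UnitSphere (m + 1) |
      Real.pi - t ≤ InnerProductGeometry.angle (x : EuclideanSpace ℝ (Fin (m + 1))) y} := by
    have h : Measurable fun y : UnitSphere (m + 1) => (x, y) := measurable_prodMk_left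
    exact (measurable_angle_unitSphere.comp h) measurableSet_Ici
  rw [← uniformSphere_sphereCap_eq_capProb x s, ← uniformSphere_antipodal_cap x t,
    ← measureReal_union ?_ hmeas]
  · rfl
  · rw [Set.disjoint_left]
    intro y h1 h2
    simp only [sphereCap, Set.mem_ofPred_eq] at h1 h2
    linarith

lemma measurable_pairAngle {p n : ℕ} (q : IndexPair n) :
    Measurable fun x : Fin n → UnitSphere p => pairAngle x q := by
  have h : Measurable fun x : Fin n → UnitSphere p => (x q.1.1, x q.1.2) :=
    (measurable_pi_apply _).prodMk (measurable_pi_apply _)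
  have h' := (measurable_angle_unitSphere (p := p)).comp h
  unfold pairAngle
  exact h'

/-- The normalized pair `(Θ_min, π - Θ_max)` for points of `𝕊^m`. -/
noncomputable def extremeAngles (m n : ℕ) (x : Fin n → UnitSphere (m + 1)) : ℝ × ℝ :=
  ((n : ℝ) ^ ((2 : ℝ) / m) * angleMin x, (n : ℝ) ^ ((2 : ℝ) / m) * (Real.pi - angleMax x))

lemma measurable_extremeAngles (m n : ℕ) : Measurable (extremeAngles m n) := by
  have h1 : Measurable fun x : Fin n → UnitSphere (m + 1) => angleMin x :=
    Measurable.iInf measurable_pairAngle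
  have h2 : Measurable fun x : Fin n → UnitSphere (m + 1) => angleMax x :=
    Measurable.iSup measurable_pairAngle
  exact (h1.const_mul _).prodMk ((h2.const_sub _).const_mul _)

lemma extremeAngles_preimage {m n : ℕ} (hn : 2 ≤ n) (s t : ℝ) :
    extremeAngles m n ⁻¹' (Set.Ioi s ×ˢ Set.Ioi t) =
      avoidEvent (extremeAngleSet (m + 1) (s * (n : ℝ) ^ (-((2 : ℝ) / m)))
        (t * (n : ℝ) ^ (-((2 : ℝ) / m)))) Finset.univ := by
  have hn0 : (0 : ℝ) < n := by positivity
  -- Only for `n ≥ 2` are the infimum and supremum attained by a pair.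
  have : Nonempty (IndexPair n) :=
    ⟨⟨(⟨0, by lia⟩, ⟨1, by lia⟩), by simp [Fin.lt_def]⟩⟩
  have hpos : 0 < (n : ℝ) ^ ((2 : ℝ) / m) := Real.rpow_pos_of_pos hn0 _
  have hscale : ∀ u v : ℝ, u < (n : ℝ) ^ ((2 : ℝ) / m) * v ↔
      u * (n : ℝ) ^ (-((2 : ℝ) / m)) < v := fun u v => by
    rw [Real.rpow_neg hn0.le, ← div_eq_mul_inv, div_lt_iff₀' hpos]
  ext x
  have hmin : ∀ c : ℝ, c < angleMin x ↔ ∀ q, c < pairAngle x q := fun c => by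
    refine ⟨fun h q => h.trans_le (ciInf_le (Set.finite_range _).bddBelow q), fun h => ?_⟩
    obtain ⟨q, hq⟩ := exists_eq_ciInf_of_finite (f := pairAngle x)
    rw [angleMin, ← hq]
    exact h q
  have hmax : ∀ c : ℝ, angleMax x < c ↔ ∀ q, pairAngle x q < c := fun c => by
    refine ⟨fun h q => (le_ciSup (Set.finite_range _).bddAbove q).trans_lt h, fun h => ?_⟩
    obtain ⟨q, hq⟩ := exists_eq_ciSup_of_finite (f := pairAngle x)
    rw [angleMax, ← hq]
    exact h q
  simp only [extremeAngles, Set.mem_preimage, Set.mem_prod, Set.mem_Ioi, hscale, avoidEvent,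
    pairEvent, extremeAngleSet, Set.mem_ofPred_eq, Finset.mem_univ, true_imp_iff, not_or, not_le,
    lt_sub_comm (b := Real.pi) (c := angleMax x), pairAngle, hmin, hmax, ← forall_and]

/-- The rates of the two caps add inside one avoidance event, so the limit exponential factors. For
negative `s` or `t` the cap is empty, whence `max s 0` and `max t 0`. -/
lemma tendsto_pi_extremeAngles {m : ℕ} (hm : m ≠ 0) (s t : ℝ) :
    Tendsto (fun n : ℕ => (Measure.pi fun _ : Fin n => uniformSphere (m + 1)).real
      (extremeAngles m n ⁻¹' (Set.Ioi s ×ˢ Set.Ioi t))) atTop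
      (nhds (Real.exp (-limitConst (m + 1) * max s 0 ^ m) *
        Real.exp (-limitConst (m + 1) * max t 0 ^ m))) := by
  have := isProbabilityMeasure_uniformSphere m.succ_ne_zero
  have hrate := (tendsto_sq_mul_capProb hm s).add (tendsto_sq_mul_capProb hm t)
  simp_rw [← mul_add] at hrate
  have hsmall := (tendsto_const_mul_rpow_neg hm s).add (tendsto_const_mul_rpow_neg hm t)
  rw [add_zero] at hsmall
  have h := tendsto_pi_avoidEvent (μ := uniformSphere (m + 1))
    (E := fun n : ℕ => extremeAngleSet (m + 1) (s * (n : ℝ) ^ (-((2 : ℝ) / m)))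
      (t * (n : ℝ) ^ (-((2 : ℝ) / m))))
    (fun n => measurableSet_extremeAngleSet _ _ _) (fun n x y => extremeAngleSet_symm)
    ((hsmall.eventually_lt_const Real.pi_pos).mono
      fun n hn => uniformSphere_section_extremeAngleSet hn) hrate
  rw [← Real.exp_add]
  have hlim : -limitConst (m + 1) * max s 0 ^ m + -limitConst (m + 1) * max t 0 ^ m =
      -(2 * limitConst (m + 1) * (max s 0 ^ m + max t 0 ^ m) / 2) := by ring
  rw [hlim]
  refine h.congr' ?_
  filter_upwards [eventually_ge_atTop 2] with n hn
  rw [extremeAngles_preimage hn]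

/-! ### Identification of the limit and conclusion -/

lemma one_sub_limitCDF {m : ℕ} (hm : m ≠ 0) (x : ℝ) :
    1 - limitCDF (m + 1) x = Real.exp (-limitConst (m + 1) * max x 0 ^ m) := by
  unfold limitCDF
  split_ifs with h
  · rw [max_eq_left h]
    simp
  · rw [max_eq_right (not_le.1 h).le, zero_pow hm]
    simp

lemma measureReal_map_Ioi {Ω' : Type*} [MeasurableSpace Ω'] {Q : Measure Ω'}
    [IsProbabilityMeasure Q] {X : Ω' → ℝ} (hX : AEMeasurable X Q) {F : ℝ → ℝ}
    (hF : ∀ x, Q.real {ω | X ω ≤ x} = F x) (s : ℝ) : (Q.map X).real (Set.Ioi s) = 1 - F s := by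
  have := Measure.isProbabilityMeasure_map hX
  rw [← Set.compl_Iic, probReal_compl_eq_one_sub measurableSet_Iic,
    map_measureReal_apply_of_aemeasurable hX measurableSet_Iic, ← hF]
  rfl

theorem theorem3 (p : ℕ) (hp : 2 ≤ p)
    -- for every `n`, independent uniform random points `X₁, …, Xₙ` on a probability space
    {Ω : ℕ → Type*} [∀ n, MeasurableSpace (Ω n)]
    (P : (n : ℕ) → Measure (Ω n)) [∀ n, IsProbabilityMeasure (P n)]
    (pts : (n : ℕ) → Fin n → Ω n → UnitSphere p)
    (hlaw : ∀ n i, HasLaw (pts n i) (uniformSphere p) (P n))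
    (hindep : ∀ n, iIndepFun (pts n) (P n))
    -- i.i.d. random variables `X`, `Y` with distribution function `F`
    {Ω' : Type*} [MeasurableSpace Ω'] (Q : Measure Ω') [IsProbabilityMeasure Q]
    (X Y : Ω' → ℝ) (hX : AEMeasurable X Q) (hY : AEMeasurable Y Q)
    (hXF : ∀ x, Q.real {ω | X ω ≤ x} = limitCDF p x)
    (hYF : ∀ x, Q.real {ω | Y ω ≤ x} = limitCDF p x)
    (hXY : IndepFun X Y Q) :
    TendstoInDistribution
      (fun (n : ℕ) ω => (n : ℝ) ^ ((2 : ℝ) / ((p : ℝ) - 1)) *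
        (angleMax (fun i => pts n i ω) + angleMin (fun i => pts n i ω) - Real.pi))
      atTop (fun ω => X ω - Y ω) P Q := by
  obtain ⟨m, rfl⟩ : ∃ m, p = m + 1 := ⟨p - 1, by lia⟩
  have hm : m ≠ 0 := by lia
  have hpts : ∀ n, AEMeasurable (fun ω i => pts n i ω) (P n) := fun n =>
    aemeasurable_pi_lambda _ fun i => (hlaw n i).aemeasurable
  have hmap : ∀ n, (P n).map (fun ω i => pts n i ω) =
      Measure.pi fun _ : Fin n => uniformSphere (m + 1) := fun n => by
    rw [(hindep n).map_fun_eq_pi_map fun i => (hlaw n i).aemeasurable]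
    simp only [(hlaw n _).map_eq]
  have hjoint : TendstoInDistribution
      (fun (n : ℕ) ω => extremeAngles m n fun i => pts n i ω) atTop
      (fun ω => (X ω, Y ω)) P Q := by
    have hae : ∀ n : ℕ, AEMeasurable (fun ω => extremeAngles m n fun i => pts n i ω) (P n) :=
      fun n => (measurable_extremeAngles m n).comp_aemeasurable (hpts n)
    refine ⟨hae, hX.prodMk hY, tendsto_probabilityMeasure_of_tendsto_survival fun s t => ?_⟩
    have hlim : (Q.map fun ω => (X ω, Y ω)).real (Set.Ioi s ×ˢ Set.Ioi t) =
        Real.exp (-limitConst (m + 1) * max s 0 ^ m) *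
          Real.exp (-limitConst (m + 1) * max t 0 ^ m) := by
      rw [(indepFun_iff_map_prod_eq_prod_map_map hX hY).1 hXY, measureReal_prod_prod,
        measureReal_map_Ioi hX hXF, measureReal_map_Ioi hY hYF, one_sub_limitCDF hm,
        one_sub_limitCDF hm]
    simp only [ProbabilityMeasure.coe_mk]
    rw [hlim]
    refine (tendsto_pi_extremeAngles hm s t).congr fun n => ?_
    have hset := measurable_extremeAngles m n
      (measurableSet_Ioi.prod measurableSet_Ioi : MeasurableSet (Set.Ioi s ×ˢ Set.Ioi t))
    rw [← hmap n, map_measureReal_apply_of_aemeasurable (hpts n) hset,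
      map_measureReal_apply_of_aemeasurable (hae n) (measurableSet_Ioi.prod measurableSet_Ioi)]
    rfl
  -- The difference of the coordinates is `Θ_min - (π - Θ_max)`, the required combination; `p - 1`
  -- becomes `m` in the exponent.
  have hdiff := hjoint.continuous_comp (g := fun z : ℝ × ℝ => z.1 - z.2) (by fun_prop)
  refine hdiff.congr (fun n => Eventually.of_forall fun ω => ?_) (Eventually.of_forall fun ω => rfl)
  simp only [Function.comp_apply, extremeAngles, Nat.cast_add, Nat.cast_one, add_sub_cancel_right]
  ring
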